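/- **Theorem (Kasteleyn, Temperley–Fisher).** Let $\mathcal G=(B\cup W,E)$ be a finite planar bipartite graph with black vertices $B$ and white vertices $W$; parallel edges are allowed and $\mathcal G$ need not be connected. It is given together with a planar embedding, recorded by its rotation system: the cyclic order of the edges around each vertex, where every connected component with at least one edge has genus $0$, i.e. satisfies $\#\text{vertices}-\#\text{edges}+\#\text{faces}=2$. The faces of a component are the closed boundary walks determined by the rotation system, and the number of edges of a face is the length of its walk (an edge with the same face on both of its sides counts twice). In each component one face may be designated as the outer (unbounded) face. Let $w:E\to\mathbb R_{>0}$ be edge weights and let $$Z=\sum_M\prod_{e\in M}w(e),$$ where $M$ runs over the dimer coverings of $\mathcal G$, i.e. the sets of edges such that every vertex is an endpoint of exactly one edge of the set. Let $\varepsilon$ be a Kasteleyn weighting, i.e. one of the following: * a choice of signs $\varepsilon:E\to\{\pm1\}$ such that each non-outer face with $0 \bmod 4$ edges has an odd number of $-$ signs and each non-outer face with $2\bmod 4$ edges has an even number of $-$ signs; or * a function $\varepsilon:E\to\{z\in\mathbb C:|z|=1\}$ such that, for each non-outer face with edges $e_1,\dots,e_{2k}$ in cyclic order, $e_1$ being traversed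 from black to white, the alternating product $\frac{\varepsilon(e_1)\varepsilon(e_3)\cdots\varepsilon(e_{2k-1})}{\varepsilon(e_2)\varepsilon(e_4)\cdots\varepsilon(e_{2k})}$ is negative real if $2k\equiv 0 \bmod 4$ and positive real if $2k\equiv 2\bmod 4$. Let $K$ be the $|B|\times|W|$ Kasteleyn matrix, $K(b,\mathrm w)=\sum_e \varepsilon(e)\,w(e)$, the sum being over the edges $e$ joining $b$ and $\mathrm w$ (so $K(b,\mathrm w)=0$ if there is none). Then $$Z=|\det K|.$$ Here, if $|B|=|W|$, the determinant is taken with respect to any bijection between $B$ and $W$ (its modulus does not depend on the choice), and if $|B|\ne|W|$, then $\det K$ is read as $0$, i.e. $Z=0$. -/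

import Mathlib

/-- A finite bipartite graph drawn on oriented closed surfaces, given by its rotation system (a
combinatorial map).  `B` and `W` are the black and the white vertices, `E` the edges; every edge has
one black and one white end, and parallel edges and isolated vertices are allowed.  The drawing is
recorded by the counterclockwise cyclic order of the edges around every vertex: `rotB e` is the edge
that follows `e` around the black end of `e`, and `rotW e` the one that follows `e` around its white
end.  The two axioms say that around each vertex the rotation is one single cycle through all the
edges at that vertex. -/
structure BipartiteMap (B W E : Type*) where
  black : E → B
  white : E → W
  rotB : Equiv.Perm E
  rotW : Equiv.Perm E
  rotB_sameCycle : ∀ e e' : E, rotB.SameCycle e e' ↔ black e = black e'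
  rotW_sameCycle : ∀ e e' : E, rotW.SameCycle e e' ↔ white e = white e'

namespace BipartiteMap

variable {B W E : Type*}

/-- The map that sends a directed edge to the next one along the boundary of the face on its side.
A directed edge is a pair: `(e, true)` is `e` traversed from black to white, `(e, false)` is `e`
traversed from white to black.  At the vertex that is reached, the walk takes the edge that follows
`e` in the rotation there. -/
def facePerm (G : BipartiteMap B W E) : Equiv.Perm (E × Bool) where
  toFun d := if d.2 then (G.rotW d.1, false) else (G.rotB d.1, true)
  invFun d := if d.2 then (G.rotB.symm d.1, false) else (G.rotW.symm d.1, true)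
  left_inv := by rintro ⟨e, _ | _⟩ <;> simp
  right_inv := by rintro ⟨e, _ | _⟩ <;> simp

/-- Faces (boundary walks of faces): the orbits of directed edges under `facePerm`. -/
def Face (G : BipartiteMap B W E) : Type _ :=
  Quotient (Equiv.Perm.SameCycle.setoid G.facePerm)

/-- The face whose boundary walk contains the directed edge `d`. -/
def faceOf (G : BipartiteMap B W E) (d : E × Bool) : G.Face :=
  Quotient.mk (Equiv.Perm.SameCycle.setoid G.facePerm) d

open Classical in
/-- The directed edges along the boundary of a face. An edge with the same face on both of its
sides occurs twice, once in each direction. -/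
noncomputable def boundary [Fintype E] (G : BipartiteMap B W E) (f : G.Face) :
    Finset (E × Bool) :=
  Finset.univ.filter fun d => G.faceOf d = f

/-- The underlying simple graph on all vertices, used for connectedness. -/
def graph (G : BipartiteMap B W E) : SimpleGraph (B ⊕ W) :=
  SimpleGraph.fromRel fun x y => ∃ e, x = Sum.inl (G.black e) ∧ y = Sum.inr (G.white e)

/-- The connected component of an edge. -/
def edgeComponent (G : BipartiteMap B W E) (e : E) : G.graph.ConnectedComponent :=
  G.graph.connectedComponentMk (Sum.inl (G.black e))

/-- The face `f` belongs to the connected component `c`. -/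
def FaceIn (G : BipartiteMap B W E) (f : G.Face) (c : G.graph.ConnectedComponent) : Prop :=
  ∃ d : E × Bool, G.faceOf d = f ∧ G.edgeComponent d.1 = c

/-- The rotation system is planar (of genus zero): each connected component that has an edge
satisfies Euler's formula `#vertices - #edges + #faces = 2`.  (An isolated vertex is always
planar.) -/
def IsPlanar (G : BipartiteMap B W E) : Prop :=
  ∀ c : G.graph.ConnectedComponent, (∃ e, G.edgeComponent e = c) →
    Nat.card {v : B ⊕ W // G.graph.connectedComponentMk v = c}
        + Nat.card {f : G.Face // G.FaceIn f c}
      = Nat.card {e : E // G.edgeComponent e = c} + 2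

/-- A choice of unbounded faces for a drawing in the plane: at most one for each connected
component. For a component without a chosen face no face is treated as unbounded. -/
def IsOuter (G : BipartiteMap B W E) (outer : Set G.Face) : Prop :=
  ∀ c : G.graph.ConnectedComponent, ∀ f ∈ outer, ∀ f' ∈ outer,
    G.FaceIn f c → G.FaceIn f' c → f = f'

/-- `ε` is a Kasteleyn weighting by signs: along a face with `0 mod 4` edges the number of minus
signs is odd, along a face with `2 mod 4` edges it is even. The condition is imposed on all faces
outside of `outer`. -/
def IsKasteleyn [Fintype E] (G : BipartiteMap B W E) (outer : Set G.Face) (ε : E → ℤˣ) : Prop :=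
  ∀ f ∉ outer,
    ((G.boundary f).card % 4 = 0 → Odd ((G.boundary f).filter fun d => ε d.1 = -1).card) ∧
    ((G.boundary f).card % 4 = 2 → Even ((G.boundary f).filter fun d => ε d.1 = -1).card)

/-- The alternating product `z(e₁) z(e₃) ⋯ / (z(e₂) z(e₄) ⋯)` of edge weights around a face whose
edges are `e₁, e₂, …` in cyclic order: edges traversed from black to white are in the numerator,
edges traversed from white to black in the denominator. -/
noncomputable def altProd [Fintype E] (G : BipartiteMap B W E) (z : E → ℂ) (f : G.Face) : ℂ :=
  ∏ d ∈ G.boundary f, if d.2 then z d.1 else (z d.1)⁻¹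

/-- `z` is a Kasteleyn weighting by complex numbers of modulus `1`: the alternating product around
a face is negative real if the face has `0 mod 4` edges, and positive real if it has `2 mod 4`
edges. The condition is imposed on all faces outside of `outer`. -/
def IsComplexKasteleyn [Fintype E] (G : BipartiteMap B W E) (outer : Set G.Face) (z : E → ℂ) :
    Prop :=
  (∀ e, ‖z e‖ = 1) ∧ ∀ f ∉ outer,
    ((G.boundary f).card % 4 = 0 → ∃ r : ℝ, r < 0 ∧ G.altProd z f = r) ∧
    ((G.boundary f).card % 4 = 2 → ∃ r : ℝ, 0 < r ∧ G.altProd z f = r)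

/-- A dimer covering: a set of edges such that every vertex is the end of exactly one of them. -/
def IsDimerCovering (G : BipartiteMap B W E) (M : Finset E) : Prop :=
  (∀ b, ∃! e, e ∈ M ∧ G.black e = b) ∧ (∀ w, ∃! e, e ∈ M ∧ G.white e = w)

open Classical in
/-- The partition function: the sum over all dimer coverings of the product of the weights. -/
noncomputable def partitionFunction [Fintype E] (G : BipartiteMap B W E) (wt : E → ℝ) : ℝ :=
  ∑ M ∈ (Finset.univ : Finset (Finset E)).filter G.IsDimerCovering, ∏ e ∈ M, wt e

open Classical in
/-- The black-white adjacency matrix with weights `k`; parallel edges add up. -/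
noncomputable def adjMatrix {R : Type*} [AddCommMonoid R] [Fintype E] (G : BipartiteMap B W E)
    (k : E → R) : Matrix B W R :=
  Matrix.of fun b w => ∑ e ∈ Finset.univ.filter (fun e => G.black e = b ∧ G.white e = w), k e

/-- The Kasteleyn matrix of a weighting by signs. -/
noncomputable def kasteleynMatrix [Fintype E] (G : BipartiteMap B W E) (ε : E → ℤˣ) (wt : E → ℝ) :
    Matrix B W ℝ :=
  G.adjMatrix fun e => ((ε e : ℤ) : ℝ) * wt e

/-- The Kasteleyn matrix of a weighting by complex numbers. -/
noncomputable def complexKasteleynMatrix [Fintype E] (G : BipartiteMap B W E) (z : E → ℂ)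
    (wt : E → ℝ) : Matrix B W ℂ :=
  G.adjMatrix fun e => z e * (wt e : ℂ)

end BipartiteMap

/-- The sign of a permutation in terms of the number of its orbits, the orbits being the fibres of
`p`. -/
theorem Equiv.Perm.sign_eq_of_orbits {α ι : Type*} [Fintype α] [DecidableEq α] [Fintype ι]
    (f : Equiv.Perm α) (p : α → ι) (hp : Function.Surjective p)
    (h : ∀ x y, f.SameCycle x y ↔ p x = p y) :
    Equiv.Perm.sign f = (-1) ^ (Fintype.card α + Fintype.card ι) := by
  classical
  choose t ht using hp
  have hinj : Function.Injective t := fun i j hij => by rw [← ht i, ← ht j, hij]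
  have h1 : (Finset.univ.filter fun i => t i ∈ f.support).card = f.cycleFactorsFinset.card := by
    refine Finset.card_bij (fun i _ => f.cycleOf (t i)) ?_ ?_ ?_
    · intro i hi
      exact Equiv.Perm.cycleOf_mem_cycleFactorsFinset_iff.2 (Finset.mem_filter.1 hi).2
    · intro i hi j hj hij
      have := (Equiv.Perm.sameCycle_iff_cycleOf_eq_of_mem_support (Finset.mem_filter.1 hi).2
        (Finset.mem_filter.1 hj).2).2 hij
      rw [h, ht, ht] at this
      exact this
    · intro c hc
      obtain ⟨a, ha⟩ := (Equiv.Perm.mem_cycleFactorsFinset_iff.1 hc).1.nonempty_support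
      have hca := Equiv.Perm.cycle_is_cycleOf ha hc
      have hs : f.SameCycle a (t (p a)) := by rw [h, ht]
      refine ⟨p a, ?_, ?_⟩
      · rw [Finset.mem_filter, ← Equiv.Perm.cycleOf_mem_cycleFactorsFinset_iff, ← hs.cycleOf_eq,
          ← hca]
        exact ⟨Finset.mem_univ _, hc⟩
      · rw [hca, hs.cycleOf_eq]
  have h2 : (Finset.univ.filter fun i => ¬ t i ∈ f.support).card = (f.support)ᶜ.card := by
    refine Finset.card_bij (fun i _ => t i) ?_ (fun i _ j _ hij => hinj hij) ?_
    · intro i hi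
      exact Finset.mem_compl.2 (Finset.mem_filter.1 hi).2
    · intro a ha
      have hfix : Function.IsFixedPt f a := by simpa [Function.IsFixedPt] using ha
      have hs : f.SameCycle a (t (p a)) := by rw [h, ht]
      have hta : t (p a) = a := (hs.eq_of_left hfix).symm
      exact ⟨p a, Finset.mem_filter.2 ⟨Finset.mem_univ _, by rw [hta]; exact Finset.mem_compl.1 ha⟩,
        hta⟩
  have h3 := Finset.card_filter_add_card_filter_not (s := (Finset.univ : Finset ι))
    (fun i => t i ∈ f.support)
  have h4 := Finset.card_add_card_compl f.support
  rw [Finset.card_univ] at h3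
  have h5 : Multiset.card f.cycleType = f.cycleFactorsFinset.card := by
    rw [Equiv.Perm.cycleType_def, Multiset.card_map]; rfl
  rw [Equiv.Perm.sign_of_cycleType, Equiv.Perm.sum_cycleType, h5]
  have : Fintype.card α + Fintype.card ι
      = (f.support.card + f.cycleFactorsFinset.card) + 2 * (f.support)ᶜ.card := by omega
  rw [this, pow_add _ _ (2 * _), pow_mul]
  simp

namespace Transversal

variable {E V : Type*} {v : E → V} {M M₁ M₂ : Finset E}

/-- The element of the transversal `M` in the fibre over `x`. -/
noncomputable def pick (h : ∀ x, ∃! e, e ∈ M ∧ v e = x) (x : V) : E := (h x).choose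

theorem pick_mem (h : ∀ x, ∃! e, e ∈ M ∧ v e = x) (x : V) : pick h x ∈ M :=
  (h x).choose_spec.1.1

theorem vertex_pick (h : ∀ x, ∃! e, e ∈ M ∧ v e = x) (x : V) : v (pick h x) = x :=
  (h x).choose_spec.1.2

theorem eq_of_mem (h : ∀ x, ∃! e, e ∈ M ∧ v e = x) {e e' : E} (he : e ∈ M) (he' : e' ∈ M)
    (hv : v e = v e') : e = e' :=
  (h (v e)).unique ⟨he, rfl⟩ ⟨he', hv.symm⟩

theorem pick_apply (h : ∀ x, ∃! e, e ∈ M ∧ v e = x) {e : E} (he : e ∈ M) : pick h (v e) = e :=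
  eq_of_mem h (pick_mem h _) he (vertex_pick h _)

open Classical in
/-- The map that exchanges the elements of two transversals in each fibre. -/
noncomputable def exchangeFun (h₁ : ∀ x, ∃! e, e ∈ M₁ ∧ v e = x)
    (h₂ : ∀ x, ∃! e, e ∈ M₂ ∧ v e = x) (e : E) : E :=
  if e ∈ M₁ then pick h₂ (v e) else if e ∈ M₂ then pick h₁ (v e) else e

variable (h₁ : ∀ x, ∃! e, e ∈ M₁ ∧ v e = x) (h₂ : ∀ x, ∃! e, e ∈ M₂ ∧ v e = x)

theorem exchangeFun_left {e : E} (he : e ∈ M₁) : exchangeFun h₁ h₂ e = pick h₂ (v e) := by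
  simp [exchangeFun, he]

theorem exchangeFun_right {e : E} (he : e ∈ M₂) : exchangeFun h₁ h₂ e = pick h₁ (v e) := by
  by_cases he1 : e ∈ M₁
  · rw [exchangeFun_left h₁ h₂ he1, pick_apply h₁ he1, pick_apply h₂ he]
  · simp [exchangeFun, he1, he]

theorem exchangeFun_of_notMem {e : E} (he₁ : e ∉ M₁) (he₂ : e ∉ M₂) :
    exchangeFun h₁ h₂ e = e := by
  simp [exchangeFun, he₁, he₂]

theorem exchangeFun_involutive : Function.Involutive (exchangeFun h₁ h₂) := by
  intro e
  by_cases he1 : e ∈ M₁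
  · rw [exchangeFun_left h₁ h₂ he1, exchangeFun_right h₁ h₂ (pick_mem h₂ _), vertex_pick h₂,
      pick_apply h₁ he1]
  · by_cases he2 : e ∈ M₂
    · rw [exchangeFun_right h₁ h₂ he2, exchangeFun_left h₁ h₂ (pick_mem h₁ _), vertex_pick h₁,
        pick_apply h₂ he2]
    · rw [exchangeFun_of_notMem h₁ h₂ he1 he2, exchangeFun_of_notMem h₁ h₂ he1 he2]

/-- The involution that exchanges the elements of two transversals in each fibre. -/
noncomputable def exchange : Equiv.Perm E := (exchangeFun_involutive h₁ h₂).toPerm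

theorem exchange_left {e : E} (he : e ∈ M₁) : exchange h₁ h₂ e = pick h₂ (v e) :=
  exchangeFun_left h₁ h₂ he

theorem exchange_right {e : E} (he : e ∈ M₂) : exchange h₁ h₂ e = pick h₁ (v e) :=
  exchangeFun_right h₁ h₂ he

theorem exchange_of_notMem {e : E} (he₁ : e ∉ M₁) (he₂ : e ∉ M₂) : exchange h₁ h₂ e = e :=
  exchangeFun_of_notMem h₁ h₂ he₁ he₂

theorem exchange_exchange (e : E) : exchange h₁ h₂ (exchange h₁ h₂ e) = e :=
  exchangeFun_involutive h₁ h₂ e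

theorem exchange_inv : (exchange h₁ h₂)⁻¹ = exchange h₁ h₂ :=
  (exchangeFun_involutive h₁ h₂).toPerm_symm

theorem vertex_exchange (e : E) : v (exchange h₁ h₂ e) = v e := by
  by_cases he1 : e ∈ M₁
  · rw [exchange_left h₁ h₂ he1, vertex_pick h₂]
  · by_cases he2 : e ∈ M₂
    · rw [exchange_right h₁ h₂ he2, vertex_pick h₁]
    · rw [exchange_of_notMem h₁ h₂ he1 he2]

open Classical in
/-- `c` is a height function for the difference of `M₁` and `M₂` along the cycles of `ρ`. -/
def IsHeight (ρ : Equiv.Perm E) (M₁ M₂ : Finset E) (c : E → ℤ) : Prop :=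
  ∀ e, c (ρ e) = c e + (if ρ e ∈ M₁ then 1 else 0) - (if ρ e ∈ M₂ then 1 else 0)

variable {ρ : Equiv.Perm E} (hρ : ∀ e e', ρ.SameCycle e e' ↔ v e = v e') {c : E → ℤ}

include hρ in
theorem vertex_perm (e : E) : v (ρ e) = v e :=
  ((hρ _ _).1 (Equiv.Perm.SameCycle.refl ρ e).apply_left)

include hρ in
theorem vertex_perm_pow (n : ℕ) (e : E) : v ((ρ ^ n) e) = v e :=
  (hρ _ _).1 (Equiv.Perm.SameCycle.refl ρ e).pow_left

variable [Finite E]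

include hρ in
theorem IsHeight.apply_pick (hc : IsHeight ρ M₁ M₂ c) {x : V} (hx : pick h₁ x ≠ pick h₂ x) :
    c (pick h₁ x) = c (pick h₂ x) + 1 := by
  classical
  have hsame : ρ.SameCycle (pick h₁ x) (pick h₂ x) := by
    rw [hρ, vertex_pick h₁, vertex_pick h₂]
  have hex : ∃ n : ℕ, (ρ ^ n) (pick h₁ x) = pick h₂ x := by
    obtain ⟨n, -, hn⟩ := hsame.exists_pow_eq'
    exact ⟨n, hn⟩
  have hv : ∀ n : ℕ, v ((ρ ^ n) (pick h₁ x)) = x := fun n => by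
    rw [vertex_perm_pow hρ, vertex_pick h₁]
  have hconst : ∀ j < Nat.find hex, c ((ρ ^ j) (pick h₁ x)) = c (pick h₁ x) := by
    intro j
    induction j with
    | zero => intro _; simp
    | succ j ih =>
      intro hj
      have hn1 : (ρ ^ (j + 1)) (pick h₁ x) ∉ M₁ := by
        intro hmem
        have heq := eq_of_mem h₁ hmem (pick_mem h₁ x) (by rw [hv, vertex_pick h₁])
        refine Nat.find_min hex (m := Nat.find hex - (j + 1)) (by omega) ?_
        have hspec := Nat.find_spec hex
        rw [← Nat.sub_add_cancel hj.le, pow_add, Equiv.Perm.mul_apply, heq] at hspec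
        exact hspec
      have hn2 : (ρ ^ (j + 1)) (pick h₁ x) ∉ M₂ := fun hmem =>
        Nat.find_min hex hj
          (eq_of_mem h₂ hmem (pick_mem h₂ x) (by rw [hv, vertex_pick h₂]))
      rw [pow_succ', Equiv.Perm.mul_apply] at hn1 hn2 ⊢
      rw [hc, if_neg hn1, if_neg hn2, ih (by omega)]
      ring
  obtain ⟨k, hk⟩ : ∃ k, Nat.find hex = k + 1 := by
    refine Nat.exists_eq_succ_of_ne_zero fun h0 => hx ?_
    have := Nat.find_spec hex
    rw [h0] at this
    simpa using this
  have hspec := Nat.find_spec hex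
  have hck := hconst k (by omega)
  rw [hk, pow_succ', Equiv.Perm.mul_apply] at hspec
  have hlast := hc ((ρ ^ k) (pick h₁ x))
  have hnot : pick h₂ x ∉ M₁ := fun hmem =>
    hx (eq_of_mem h₁ (pick_mem h₁ x) hmem (by rw [vertex_pick h₁, vertex_pick h₂]))
  rw [hspec, hck, if_neg hnot, if_pos (pick_mem h₂ x)] at hlast
  linarith

include hρ in
open Classical in
theorem IsHeight.apply_exchange (hc : IsHeight ρ M₁ M₂ c) (e : E) :
    c (exchange h₁ h₂ e) = c e - (if e ∈ M₁ then 1 else 0) + (if e ∈ M₂ then 1 else 0) := by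
  by_cases he1 : e ∈ M₁ <;> by_cases he2 : e ∈ M₂
  · rw [exchange_left h₁ h₂ he1, pick_apply h₂ he2]; simp [he1, he2]
  · have hne : pick h₁ (v e) ≠ pick h₂ (v e) := fun h => he2 (by
      rw [pick_apply h₁ he1] at h; rw [h]; exact pick_mem h₂ _)
    have := hc.apply_pick h₁ h₂ hρ hne
    rw [pick_apply h₁ he1] at this
    rw [exchange_left h₁ h₂ he1, this]; simp [he1, he2]
  · have hne : pick h₁ (v e) ≠ pick h₂ (v e) := fun h => he1 (by
      rw [pick_apply h₂ he2] at h; rw [← h]; exact pick_mem h₁ _)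
    have := hc.apply_pick h₁ h₂ hρ hne
    rw [pick_apply h₂ he2] at this
    rw [exchange_right h₁ h₂ he2, this]; simp [he1, he2]
  · rw [exchange_of_notMem h₁ h₂ he1 he2]; simp [he1, he2]

include hρ in
theorem IsHeight.exchange_mul (hc : IsHeight ρ M₁ M₂ c) (e : E) :
    c ((exchange h₁ h₂ * ρ) e) = c e := by
  rw [Equiv.Perm.mul_apply, hc.apply_exchange h₁ h₂ hρ, hc e]
  ring

include hρ in
theorem exists_sameCycle_exchange_mul (e : E) :
    ∃ a, (a ∈ M₁ ∨ a ∈ M₂) ∧ (exchange h₁ h₂ * ρ).SameCycle e a := by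
  have key : ∀ n : ℕ, ∃ a, (a ∈ M₁ ∨ a ∈ M₂) ∧
      (exchange h₁ h₂ * ρ).SameCycle ((ρ ^ n) (pick h₁ (v e))) a := by
    intro n
    induction n with
    | zero => exact ⟨_, Or.inl (pick_mem h₁ _), Equiv.Perm.SameCycle.refl _ _⟩
    | succ n ih =>
      obtain ⟨a, ha, hs⟩ := ih
      by_cases hm : (ρ ^ (n + 1)) (pick h₁ (v e)) ∈ M₁ ∨ (ρ ^ (n + 1)) (pick h₁ (v e)) ∈ M₂
      · exact ⟨_, hm, Equiv.Perm.SameCycle.refl _ _⟩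
      · push Not at hm
        refine ⟨a, ha, ?_⟩
        have h := exchange_of_notMem h₁ h₂ hm.1 hm.2
        rw [pow_succ', Equiv.Perm.mul_apply] at h ⊢
        rw [← h]
        exact hs.apply_left
  have hsame : ρ.SameCycle (pick h₁ (v e)) e := by rw [hρ, vertex_pick h₁]
  obtain ⟨n, -, hn⟩ := hsame.exists_pow_eq'
  simpa [hn] using key n

theorem apply_eq_of_sameCycle {α β : Type*} {f : Equiv.Perm α} {g : α → β}
    (hg : ∀ x, g (f x) = g x) {x y : α} (h : f.SameCycle x y) : g x = g y := by
  obtain ⟨n, rfl⟩ := h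
  induction n using Int.induction_on generalizing x with
  | zero => simp
  | succ n ih => rw [zpow_add_one, Equiv.Perm.mul_apply, ← ih, hg]
  | pred n ih =>
    rw [zpow_sub_one, Equiv.Perm.mul_apply, ← ih]
    conv_lhs => rw [← f.apply_symm_apply x, hg]
    rfl

include hρ in
open Classical in
/-- The sign of `ρ`, modified by the exchange of two transversals, on the edges of odd height. -/
theorem IsHeight.sign_exchange_mul [Fintype E] (hc : IsHeight ρ M₁ M₂ c)
    (hS : ∀ e, Odd (c ((exchange h₁ h₂ * ρ) e)) ↔ Odd (c e)) :
    Equiv.Perm.sign ((exchange h₁ h₂ * ρ).subtypePerm (p := fun e => Odd (c e)) hS)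
      = (-1) ^ (Fintype.card {e // Odd (c e)}
          + Fintype.card {e // Odd (c e) ∧ (e ∈ M₁ ∨ e ∈ M₂)}) := by
  choose a ha hsa using exists_sameCycle_exchange_mul (ρ := ρ) h₁ h₂ hρ
  have hcs : ∀ {x y}, (exchange h₁ h₂ * ρ).SameCycle x y → c x = c y :=
    apply_eq_of_sameCycle (hc.exchange_mul h₁ h₂ hρ)
  have hvs : ∀ {x y}, (exchange h₁ h₂ * ρ).SameCycle x y → v x = v y :=
    apply_eq_of_sameCycle fun x => by
      rw [Equiv.Perm.mul_apply, vertex_exchange h₁ h₂, vertex_perm hρ]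
  have huniq : ∀ {x y}, (x ∈ M₁ ∨ x ∈ M₂) → (y ∈ M₁ ∨ y ∈ M₂) →
      (exchange h₁ h₂ * ρ).SameCycle x y → x = y := by
    have aux : ∀ {x y}, x ∈ M₁ → y ∈ M₂ → (exchange h₁ h₂ * ρ).SameCycle x y → x = y := by
      intro x y hx hy hs
      by_contra hne
      have h := hc.apply_pick h₁ h₂ hρ (x := v x) (by
        rw [pick_apply h₁ hx, hvs hs, pick_apply h₂ hy]; exact hne)
      rw [pick_apply h₁ hx, hvs hs, pick_apply h₂ hy, hcs hs] at h
      omega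
    intro x y hx hy hs
    rcases hx with hx | hx <;> rcases hy with hy | hy
    · exact eq_of_mem h₁ hx hy (hvs hs)
    · exact aux hx hy hs
    · exact (aux hy hx hs.symm).symm
    · exact eq_of_mem h₂ hx hy (hvs hs)
  refine Equiv.Perm.sign_eq_of_orbits _
    (fun e => ⟨a e.1, by rw [← hcs (hsa e.1)]; exact e.2, ha e.1⟩) ?_ ?_
  · rintro ⟨e, he, hm⟩
    exact ⟨⟨e, he⟩, Subtype.ext (huniq hm (ha e) (hsa e)).symm⟩
  · rintro ⟨x, hx⟩ ⟨y, hy⟩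
    rw [Equiv.Perm.sameCycle_subtypePerm, Subtype.mk.injEq]
    refine ⟨fun h => huniq (ha x) (ha y) ((hsa x).symm.trans (h.trans (hsa y))), fun h => ?_⟩
    have := hsa x
    simp only at h
    rw [h] at this
    exact this.trans (hsa y).symm

end Transversal

theorem Equiv.Perm.apply_inv_apply {α : Type*} (f : Equiv.Perm α) (x : α) : f (f⁻¹ x) = x :=
  f.apply_symm_apply x

theorem Int.odd_add_one_iff (n : ℤ) : Odd (n + 1) ↔ ¬ Odd n := by
  rw [← Int.not_even_iff_odd, Int.even_add_one, Int.not_even_iff_odd]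

namespace BipartiteMap

open Transversal

variable {B W E : Type*} {G : BipartiteMap B W E} {M M₁ M₂ : Finset E}

theorem IsDimerCovering.existsUnique_black (h : G.IsDimerCovering M) :
    ∀ b, ∃! e, e ∈ M ∧ G.black e = b := h.1

theorem IsDimerCovering.existsUnique_white (h : G.IsDimerCovering M) :
    ∀ w, ∃! e, e ∈ M ∧ G.white e = w := h.2

/-- The bijection between black and white vertices given by a dimer covering. -/
noncomputable def IsDimerCovering.matching (h : G.IsDimerCovering M) : B ≃ W where
  toFun b := G.white (pick h.existsUnique_black b)
  invFun w := G.black (pick h.existsUnique_white w)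
  left_inv b := by
    beta_reduce
    rw [pick_apply h.existsUnique_white (pick_mem h.existsUnique_black b), vertex_pick h.existsUnique_black]
  right_inv w := by
    beta_reduce
    rw [pick_apply h.existsUnique_black (pick_mem h.existsUnique_white w), vertex_pick h.existsUnique_white]

theorem IsDimerCovering.matching_black (h : G.IsDimerCovering M) {e : E} (he : e ∈ M) :
    h.matching (G.black e) = G.white e := by
  change G.white (pick h.existsUnique_black _) = _
  rw [pick_apply h.existsUnique_black he]

theorem IsDimerCovering.matching_symm_white (h : G.IsDimerCovering M) {e : E} (he : e ∈ M) :
    h.matching.symm (G.white e) = G.black e := by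
  rw [Equiv.symm_apply_eq, h.matching_black he]

theorem isHeight_rotB_inv {c : E → ℤ} (hφ : ∀ e, c (G.rotB (G.rotW e)) = c e)
    (hc : IsHeight G.rotW M₁ M₂ c) : IsHeight G.rotB⁻¹ M₁ M₂ c := by
  intro e
  have h1 := hφ (G.rotW⁻¹ (G.rotB⁻¹ e))
  have h2 := hc (G.rotW⁻¹ (G.rotB⁻¹ e))
  rw [Equiv.Perm.apply_inv_apply, Equiv.Perm.apply_inv_apply] at h1
  rw [Equiv.Perm.apply_inv_apply] at h2
  rw [h1]
  exact h2

/-- The rotation at a white vertex followed by the one at the next black vertex; its cycles are the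
faces. -/
def rotWB (G : BipartiteMap B W E) : Equiv.Perm E := G.rotB * G.rotW

theorem black_exchange_exchange_of_mem_left (h₁ : G.IsDimerCovering M₁)
    (h₂ : G.IsDimerCovering M₂) {e : E} (he : e ∈ M₁) :
    G.black ((exchange h₁.existsUnique_black h₂.existsUnique_black * exchange h₁.existsUnique_white h₂.existsUnique_white) e)
      = h₂.matching.symm (h₁.matching (G.black e)) := by
  rw [Equiv.Perm.mul_apply, vertex_exchange h₁.existsUnique_black, exchange_left h₁.existsUnique_white h₂.existsUnique_white he, h₁.matching_black he,
    ← h₂.matching_symm_white (pick_mem h₂.existsUnique_white _), vertex_pick h₂.existsUnique_white]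

theorem black_exchange_exchange_of_mem_right (h₁ : G.IsDimerCovering M₁)
    (h₂ : G.IsDimerCovering M₂) {e : E} (he : e ∈ M₂) :
    G.black ((exchange h₁.existsUnique_black h₂.existsUnique_black * exchange h₁.existsUnique_white h₂.existsUnique_white) e)
      = h₁.matching.symm (h₂.matching (G.black e)) := by
  rw [Equiv.Perm.mul_apply, vertex_exchange h₁.existsUnique_black, exchange_right h₁.existsUnique_white h₂.existsUnique_white he, h₂.matching_black he,
    ← h₁.matching_symm_white (pick_mem h₁.existsUnique_white _), vertex_pick h₁.existsUnique_white]

theorem exchange_exchange_of_notMem (h₁ : G.IsDimerCovering M₁)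
    (h₂ : G.IsDimerCovering M₂) {e : E} (he₁ : e ∉ M₁) (he₂ : e ∉ M₂) :
    (exchange h₁.existsUnique_black h₂.existsUnique_black * exchange h₁.existsUnique_white h₂.existsUnique_white) e = e := by
  rw [Equiv.Perm.mul_apply, exchange_of_notMem _ _ he₁ he₂, exchange_of_notMem _ _ he₁ he₂]

theorem exchange_exchange_mem_left (h₁ : G.IsDimerCovering M₁)
    (h₂ : G.IsDimerCovering M₂) {e : E} (he : e ∈ M₁) :
    (exchange h₁.existsUnique_black h₂.existsUnique_black * exchange h₁.existsUnique_white h₂.existsUnique_white) e ∈ M₁ := by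
  rw [Equiv.Perm.mul_apply, exchange_left h₁.existsUnique_white h₂.existsUnique_white he, exchange_right h₁.existsUnique_black h₂.existsUnique_black (pick_mem _ _)]
  exact pick_mem _ _

open Classical in
theorem sign_exchange_exchange [Fintype E] [Fintype B] (h₁ : G.IsDimerCovering M₁)
    (h₂ : G.IsDimerCovering M₂) {c : E → ℤ} (hcB : IsHeight G.rotB⁻¹ M₁ M₂ c)
    (hc : ∀ e, c ((exchange h₁.existsUnique_black h₂.existsUnique_black * exchange h₁.existsUnique_white h₂.existsUnique_white) e) = c e)
    (hS : ∀ e, Odd (c ((exchange h₁.existsUnique_black h₂.existsUnique_black * exchange h₁.existsUnique_white h₂.existsUnique_white) e)) ↔ Odd (c e)) :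
    Equiv.Perm.sign ((exchange h₁.existsUnique_black h₂.existsUnique_black * exchange h₁.existsUnique_white h₂.existsUnique_white).subtypePerm
        (p := fun e => Odd (c e)) hS)
      = Equiv.Perm.sign (h₁.matching.trans h₂.matching.symm) := by
  set θ : Equiv.Perm B := h₁.matching.trans h₂.matching.symm with hθ
  set π := exchange h₁.existsUnique_black h₂.existsUnique_black * exchange h₁.existsUnique_white h₂.existsUnique_white with hπ
  have hβ : ∀ e e', G.rotB⁻¹.SameCycle e e' ↔ G.black e = G.black e' := fun e e' => by
    rw [Equiv.Perm.sameCycle_inv, G.rotB_sameCycle]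
  have hleft : ∀ {e}, e ∈ M₁ → G.black (π e) = θ (G.black e) := fun he =>
    black_exchange_exchange_of_mem_left h₁ h₂ he
  have hright : ∀ {e}, e ∈ M₂ → G.black (π e) = θ⁻¹ (G.black e) := fun he =>
    black_exchange_exchange_of_mem_right h₁ h₂ he
  have hmem1 : ∀ {e}, e ∈ M₁ → π e ∈ M₁ := exchange_exchange_mem_left h₁ h₂
  have hmap : ∀ b, π (pick h₁.existsUnique_black b) = pick h₁.existsUnique_black (θ b) := fun b => by
    have := hleft (pick_mem h₁.existsUnique_black b)
    rw [vertex_pick h₁.existsUnique_black] at this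
    rw [← this, pick_apply h₁.existsUnique_black (hmem1 (pick_mem _ _))]
  have hθfix : ∀ {b}, pick h₁.existsUnique_black b = pick h₂.existsUnique_black b → θ b = b := fun {b} hb => by
    have hm : pick h₁.existsUnique_black b ∈ M₂ := hb ▸ pick_mem h₂.existsUnique_black b
    have h3 := h₁.matching_black (pick_mem h₁.existsUnique_black b)
    rw [vertex_pick h₁.existsUnique_black] at h3
    rw [hθ, Equiv.trans_apply, h3, h₂.matching_symm_white hm, vertex_pick h₁.existsUnique_black]
  have hP : ∀ b, Odd (c (pick h₁.existsUnique_black (θ b))) ↔ Odd (c (pick h₁.existsUnique_black b)) := fun b => by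
    rw [← hmap, hc]
  have hP' : ∀ b, ¬ Odd (c (pick h₁.existsUnique_black (θ b))) ↔ ¬ Odd (c (pick h₁.existsUnique_black b)) := fun b => not_congr (hP b)
  have hQ : ∀ b, ¬ Odd (c (pick h₁.existsUnique_black (θ⁻¹ b))) ↔ ¬ Odd (c (pick h₁.existsUnique_black b)) := fun b => by
    rw [← hP' (θ⁻¹ b), Equiv.Perm.apply_inv_apply]
  have hsign : Equiv.Perm.sign θ = Equiv.Perm.sign (Equiv.Perm.subtypeCongr
      (θ.subtypePerm (p := fun b => Odd (c (pick h₁.existsUnique_black b))) hP)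
      (θ⁻¹.subtypePerm (p := fun b => ¬ Odd (c (pick h₁.existsUnique_black b))) hQ)) := by
    have e1 : θ = Equiv.Perm.subtypeCongr
        (θ.subtypePerm (p := fun b => Odd (c (pick h₁.existsUnique_black b))) hP)
        (θ.subtypePerm (p := fun b => ¬ Odd (c (pick h₁.existsUnique_black b))) hP') := by
      ext b
      by_cases hb : Odd (c (pick h₁.existsUnique_black b))
      · rw [Equiv.Perm.subtypeCongr.left_apply (p := fun b => Odd (c (pick h₁.existsUnique_black b))) _ _ hb]; rfl
      · rw [Equiv.Perm.subtypeCongr.right_apply (p := fun b => Odd (c (pick h₁.existsUnique_black b))) _ _ hb]; rfl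
    conv_lhs => rw [e1]
    rw [Equiv.Perm.sign_subtypeCongr, Equiv.Perm.sign_subtypeCongr,
      ← Equiv.Perm.sign_inv (θ.subtypePerm (p := fun b => ¬ Odd (c (pick h₁.existsUnique_black b))) hP')]
    rfl
  rw [hsign]
  set θ' := Equiv.Perm.subtypeCongr
      (θ.subtypePerm (p := fun b => Odd (c (pick h₁.existsUnique_black b))) hP)
      (θ⁻¹.subtypePerm (p := fun b => ¬ Odd (c (pick h₁.existsUnique_black b))) hQ)
  have hθ'1 : ∀ {b}, Odd (c (pick h₁.existsUnique_black b)) → θ' b = θ b := fun hb => by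
    rw [Equiv.Perm.subtypeCongr.left_apply (p := fun b => Odd (c (pick h₁.existsUnique_black b))) _ _ hb]; rfl
  have hθ'2 : ∀ {b}, ¬ Odd (c (pick h₁.existsUnique_black b)) → θ' b = θ⁻¹ b := fun hb => by
    rw [Equiv.Perm.subtypeCongr.right_apply (p := fun b => Odd (c (pick h₁.existsUnique_black b))) _ _ hb]; rfl
  have hne : ∀ {b}, θ' b ≠ b → pick h₁.existsUnique_black b ≠ pick h₂.existsUnique_black b := fun {b} hb heq => hb (by
    by_cases ho : Odd (c (pick h₁.existsUnique_black b))
    · rw [hθ'1 ho, hθfix heq]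
    · rw [hθ'2 ho, Equiv.Perm.inv_eq_iff_eq, hθfix heq])
  have hheight : ∀ {b}, pick h₁.existsUnique_black b ≠ pick h₂.existsUnique_black b → c (pick h₁.existsUnique_black b) = c (pick h₂.existsUnique_black b) + 1 :=
    fun hb => hcB.apply_pick h₁.existsUnique_black h₂.existsUnique_black hβ hb
  have hmem : ∀ {e}, π e ≠ e → e ∈ M₁ ∨ e ∈ M₂ := fun {e} he => by
    by_contra! h
    exact he (exchange_exchange_of_notMem h₁ h₂ h.1 h.2)
  have hblack : ∀ {e}, Odd (c e) → (e ∈ M₁ ∨ e ∈ M₂) → G.black (π e) = θ' (G.black e) := by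
    intro e ho hm
    by_cases he : e ∈ M₁
    · rw [hθ'1 (by rwa [pick_apply h₁.existsUnique_black he]), hleft he]
    · have he2 := hm.resolve_left he
      have hd : pick h₁.existsUnique_black (G.black e) ≠ pick h₂.existsUnique_black (G.black e) := fun h => he (by
        rw [pick_apply h₂.existsUnique_black he2] at h
        rw [← h]
        exact pick_mem _ _)
      have := hheight hd
      rw [pick_apply h₂.existsUnique_black he2] at this
      rw [hθ'2 (by rw [this, Int.not_odd_iff_even]; exact ho.add_one), hright he2]
  have haux : ∀ {x y}, Odd (c x) → Odd (c y) → x ∈ M₁ → y ∈ M₂ → G.black x = G.black y →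
      x = y := by
    intro x y hx hy hx1 hy2 hxy
    by_contra hd
    have := hheight (b := G.black x) (by
      rw [pick_apply h₁.existsUnique_black hx1, hxy, pick_apply h₂.existsUnique_black hy2]; exact hd)
    rw [pick_apply h₁.existsUnique_black hx1, hxy, pick_apply h₂.existsUnique_black hy2] at this
    rw [this, Int.odd_add_one_iff] at hx
    exact hx hy
  refine Equiv.Perm.sign_bij (fun e _ => G.black e.1) ?_ ?_ ?_
  · rintro ⟨e, ho⟩ hx -
    exact hblack ho (hmem fun h => hx (Subtype.ext h))
  · rintro ⟨x, hox⟩ ⟨y, hoy⟩ hx hy hxy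
    refine Subtype.ext ?_
    rcases hmem fun h => hx (Subtype.ext h) with h1 | h1 <;>
      rcases hmem fun h => hy (Subtype.ext h) with h2 | h2
    · exact eq_of_mem h₁.existsUnique_black h1 h2 hxy
    · exact haux hox hoy h1 h2 hxy
    · exact (haux hoy hox h2 h1 hxy.symm).symm
    · exact eq_of_mem h₂.existsUnique_black h1 h2 hxy
  · intro b hb
    obtain ⟨e, ho, hm, rfl⟩ : ∃ e, Odd (c e) ∧ (e ∈ M₁ ∨ e ∈ M₂) ∧ G.black e = b := by
      by_cases ho : Odd (c (pick h₁.existsUnique_black b))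
      · exact ⟨_, ho, Or.inl (pick_mem _ _), vertex_pick h₁.existsUnique_black b⟩
      · refine ⟨pick h₂.existsUnique_black b, ?_, Or.inr (pick_mem _ _), vertex_pick h₂.existsUnique_black b⟩
        rwa [hheight (hne hb), Int.odd_add_one_iff, not_not] at ho
    refine ⟨⟨e, ho⟩, fun h => hb ?_, rfl⟩
    rw [← hblack ho hm]
    exact congrArg G.black (congrArg Subtype.val h)

open Classical in
/-- The sign of the face permutation on the edges of odd height is the relative sign of the two
dimer coverings. -/
theorem sign_rotWB_odd [Fintype E] [Fintype B] (h₁ : G.IsDimerCovering M₁)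
    (h₂ : G.IsDimerCovering M₂) {c : E → ℤ} (hφ : ∀ e, c (G.rotWB e) = c e)
    (hc : IsHeight G.rotW M₁ M₂ c) (hS : ∀ e, Odd (c (G.rotWB e)) ↔ Odd (c e)) :
    Equiv.Perm.sign (G.rotWB.subtypePerm (p := fun e => Odd (c e)) hS)
      = Equiv.Perm.sign (h₁.matching.trans h₂.matching.symm) := by
  have hcB := isHeight_rotB_inv hφ hc
  have hβ : ∀ e e', G.rotB⁻¹.SameCycle e e' ↔ G.black e = G.black e' := fun e e' => by
    rw [Equiv.Perm.sameCycle_inv, G.rotB_sameCycle]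
  set pB := exchange h₁.existsUnique_black h₂.existsUnique_black * G.rotB⁻¹ with hpB
  set pW := exchange h₁.existsUnique_white h₂.existsUnique_white * G.rotW with hpW
  set π := exchange h₁.existsUnique_black h₂.existsUnique_black * exchange h₁.existsUnique_white h₂.existsUnique_white with hπ
  have hB : ∀ e, c (pB e) = c e := hcB.exchange_mul h₁.existsUnique_black h₂.existsUnique_black hβ
  have hW : ∀ e, c (pW e) = c e := hc.exchange_mul h₁.existsUnique_white h₂.existsUnique_white G.rotW_sameCycle
  have hfac : G.rotWB = pB⁻¹ * π * pW := by
    ext e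
    simp [rotWB, hpB, hpW, hπ, exchange_exchange, exchange_inv]
  have hπc : ∀ e, c (π e) = c e := fun e => by
    have h := hφ (pW⁻¹ e)
    rw [hfac, Equiv.Perm.mul_apply, Equiv.Perm.mul_apply, Equiv.Perm.apply_inv_apply] at h
    rw [← hB (pB⁻¹ _), Equiv.Perm.apply_inv_apply] at h
    rw [h, ← hW, Equiv.Perm.apply_inv_apply]
  have hBo : ∀ e, Odd (c (pB e)) ↔ Odd (c e) := fun e => by rw [hB]
  have hWo : ∀ e, Odd (c (pW e)) ↔ Odd (c e) := fun e => by rw [hW]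
  have hπo : ∀ e, Odd (c (π e)) ↔ Odd (c e) := fun e => by rw [hπc]
  have hsub : G.rotWB.subtypePerm (p := fun e => Odd (c e)) hS
      = (pB.subtypePerm (p := fun e => Odd (c e)) hBo)⁻¹
        * π.subtypePerm (p := fun e => Odd (c e)) hπo
        * pW.subtypePerm (p := fun e => Odd (c e)) hWo := by
    rw [Equiv.Perm.inv_subtypePerm]
    exact Equiv.ext fun e => Subtype.ext (DFunLike.congr_fun hfac e.1)
  rw [hsub, Equiv.Perm.sign_mul, Equiv.Perm.sign_mul, Equiv.Perm.sign_inv,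
    hcB.sign_exchange_mul h₁.existsUnique_black h₂.existsUnique_black hβ hBo,
    hc.sign_exchange_mul h₁.existsUnique_white h₂.existsUnique_white G.rotW_sameCycle hWo,
    sign_exchange_exchange h₁ h₂ hcB hπc hπo, mul_right_comm, ← pow_add, ← two_mul, pow_mul]
  simp

theorem faceOf_facePerm (d : E × Bool) : G.faceOf (G.facePerm d) = G.faceOf d :=
  Quotient.sound (Equiv.Perm.SameCycle.refl G.facePerm d).apply_left

theorem faceOf_rotW (e : E) : G.faceOf (G.rotW e, false) = G.faceOf (e, true) :=
  faceOf_facePerm (G := G) (e, true)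

theorem faceOf_rotB (e : E) : G.faceOf (G.rotB e, true) = G.faceOf (e, false) :=
  faceOf_facePerm (G := G) (e, false)

theorem faceOf_rotWB (e : E) : G.faceOf (G.rotWB e, true) = G.faceOf (e, true) :=
  (faceOf_rotB (G.rotW e)).trans (faceOf_rotW e)

theorem exists_faceOf_eq (f : G.Face) : ∃ e, G.faceOf (e, true) = f := by
  obtain ⟨⟨e, b⟩, rfl⟩ := Quotient.exists_rep f
  cases b
  · exact ⟨_, faceOf_rotB e⟩
  · exact ⟨e, rfl⟩

theorem sameCycle_rotWB_iff (e e' : E) :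
    G.rotWB.SameCycle e e' ↔ G.faceOf (e, true) = G.faceOf (e', true) := by
  refine ⟨apply_eq_of_sameCycle (g := fun e => G.faceOf (e, true)) faceOf_rotWB, fun h => ?_⟩
  have hs : G.facePerm.SameCycle (e, true) (e', true) := Quotient.exact h
  let q : E × Bool → Quotient (Equiv.Perm.SameCycle.setoid G.rotWB) := fun d =>
    Quotient.mk _ (if d.2 then d.1 else G.rotB d.1)
  have hq : ∀ d, q (G.facePerm d) = q d := by
    rintro ⟨e, _ | _⟩
    · rfl
    · exact Quotient.sound (Equiv.Perm.SameCycle.refl G.rotWB e).apply_left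
  exact Quotient.exact (apply_eq_of_sameCycle hq hs)

instance [Finite E] : Finite G.Face :=
  inferInstanceAs (Finite (Quotient (Equiv.Perm.SameCycle.setoid G.facePerm)))

open Classical in
@[to_additive]
theorem prod_boundary [Fintype E] {R : Type*} [CommMonoid R] (f : G.Face) (F : E × Bool → R) :
    ∏ d ∈ G.boundary f, F d
      = ∏ e with G.faceOf (e, true) = f, F (e, true) * F (G.rotW e, false) := by
  rw [boundary, Finset.prod_filter, Fintype.prod_prod_type]
  simp only [Fintype.prod_bool]
  rw [Finset.prod_mul_distrib, Finset.prod_mul_distrib, Finset.prod_filter, Finset.prod_filter]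
  congr 1
  rw [← Equiv.prod_comp G.rotW]
  simp only [faceOf_rotW]

open Classical in
theorem card_boundary [Fintype E] (f : G.Face) :
    (G.boundary f).card = 2 * (Finset.univ.filter fun e => G.faceOf (e, true) = f).card := by
  rw [Finset.card_eq_sum_ones, sum_boundary]
  simp [mul_comm]

open Classical in
theorem altProd_eq_prod [Fintype E] (z : E → ℂ) (f : G.Face) :
    G.altProd z f = ∏ e with G.faceOf (e, true) = f, z e * (z (G.rotW e))⁻¹ := by
  rw [altProd, prod_boundary]
  simp

open Classical in
theorem IsComplexKasteleyn.altProd_eq [Fintype E] {outer : Set G.Face} {z : E → ℂ}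
    (hz : G.IsComplexKasteleyn outer z) {f : G.Face} (hf : f ∉ outer) :
    G.altProd z f = (-1) ^ ((Finset.univ.filter fun e => G.faceOf (e, true) = f).card + 1) := by
  have hnorm : ‖G.altProd z f‖ = 1 := by
    rw [altProd_eq_prod, norm_prod]
    exact Finset.prod_eq_one fun e _ => by rw [norm_mul, norm_inv, hz.1, hz.1]; simp
  have h := hz.2 f hf
  rw [card_boundary] at h
  set k := (Finset.univ.filter fun e => G.faceOf (e, true) = f).card
  rcases Nat.even_or_odd k with hk | hk
  · obtain ⟨r, hr, hr'⟩ := h.1 (by obtain ⟨m, hm⟩ := hk; omega)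
    rw [hr', Complex.norm_real, Real.norm_eq_abs, abs_of_neg hr] at hnorm
    rw [hr', hk.add_one.neg_one_pow, ← neg_eq_iff_eq_neg, ← Complex.ofReal_neg, hnorm,
      Complex.ofReal_one]
  · obtain ⟨r, hr, hr'⟩ := h.2 (by obtain ⟨m, hm⟩ := hk; omega)
    rw [hr', Complex.norm_real, Real.norm_eq_abs, abs_of_pos hr] at hnorm
    rw [hr', hk.add_one.neg_one_pow, hnorm, Complex.ofReal_one]

open Classical in
theorem prod_zpow_height [Fintype E] {z : E → ℂ} (hz : ∀ e, z e ≠ 0) {ρ : Equiv.Perm E}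
    {c : E → ℤ} (hc : IsHeight ρ M₁ M₂ c) :
    (∏ e, (z e * (z (ρ e))⁻¹) ^ c e) * ∏ e ∈ M₂, z e = ∏ e ∈ M₁, z e := by
  have h1 : ∏ e, (z e * (z (ρ e))⁻¹) ^ c e = ∏ e, z (ρ e) ^ (c (ρ e) - c e) := by
    simp only [mul_zpow, Finset.prod_mul_distrib, inv_zpow', zpow_sub₀ (hz _), div_eq_mul_inv,
      zpow_neg]
    rw [Equiv.prod_comp ρ fun e => z e ^ c e]
  have h2 : ∀ e, z (ρ e) ^ (c (ρ e) - c e)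
      = (if ρ e ∈ M₁ then z (ρ e) else 1) * (if ρ e ∈ M₂ then z (ρ e) else 1)⁻¹ := by
    intro e
    rw [hc e]
    have := hz (ρ e)
    split_ifs <;> simp [this]
  rw [h1, Finset.prod_congr rfl fun e _ => h2 e,
    Equiv.prod_comp ρ fun e => (if e ∈ M₁ then z e else 1) * (if e ∈ M₂ then z e else 1)⁻¹,
    Finset.prod_mul_distrib, Finset.prod_inv_distrib, Fintype.prod_ite_mem,
    Fintype.prod_ite_mem, inv_mul_cancel_right₀ (Finset.prod_ne_zero_iff.2 fun e _ => hz e)]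

open Classical in
theorem prod_zpow_eq_sign [Fintype E] {outer : Set G.Face} {z : E → ℂ}
    (hz : G.IsComplexKasteleyn outer z) {c : E → ℤ} (hφ : ∀ e, c (G.rotWB e) = c e)
    (hout : ∀ e, G.faceOf (e, true) ∈ outer → c e = 0)
    (hS : ∀ e, Odd (c (G.rotWB e)) ↔ Odd (c e)) :
    ∏ e, (z e * (z (G.rotW e))⁻¹) ^ c e
      = ((Equiv.Perm.sign (G.rotWB.subtypePerm (p := fun e => Odd (c e)) hS) : ℤˣ) : ℤ) := by
  have := Fintype.ofFinite G.Face
  choose t ht using exists_faceOf_eq (G := G)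
  have hct : ∀ e, c e = c (t (G.faceOf (e, true))) := fun e =>
    apply_eq_of_sameCycle hφ ((sameCycle_rotWB_iff _ _).2 (ht _).symm)
  have horb := Equiv.Perm.sign_eq_of_orbits (G.rotWB.subtypePerm (p := fun e => Odd (c e)) hS)
    (ι := {f : G.Face // Odd (c (t f))})
    (fun e => ⟨G.faceOf (e.1, true), by rw [← hct]; exact e.2⟩)
    (fun f => ⟨⟨t f.1, f.2⟩, Subtype.ext (ht _)⟩)
    (fun x y => by
      rw [Equiv.Perm.sameCycle_subtypePerm, Subtype.mk.injEq, sameCycle_rotWB_iff])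
  have hcard : Fintype.card {e // Odd (c e)}
      = ∑ f with Odd (c (t f)), (Finset.univ.filter fun e => G.faceOf (e, true) = f).card := by
    rw [Fintype.card_subtype,
      Finset.card_eq_sum_card_fiberwise (f := fun e => G.faceOf (e, true))
        (t := Finset.univ.filter fun f => Odd (c (t f)))]
    · refine Finset.sum_congr rfl fun f hf => ?_
      congr 1
      ext e
      simp only [Finset.mem_filter, Finset.mem_univ, true_and, and_iff_right_iff_imp]
      rintro rfl
      rw [hct]
      exact (Finset.mem_filter.1 hf).2
    · intro e he
      simp only [Finset.coe_filter, Finset.mem_univ, true_and, Set.mem_ofPred_eq] at he ⊢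
      rwa [← hct]
  have hface : ∀ f : G.Face, ∏ e with G.faceOf (e, true) = f, (z e * (z (G.rotW e))⁻¹) ^ c e
      = if Odd (c (t f)) then
          (-1) ^ ((Finset.univ.filter fun e => G.faceOf (e, true) = f).card + 1) else 1 := by
    intro f
    have h1 : ∏ e with G.faceOf (e, true) = f, (z e * (z (G.rotW e))⁻¹) ^ c e
        = G.altProd z f ^ c (t f) := by
      rw [altProd_eq_prod, ← Finset.prod_zpow]
      refine Finset.prod_congr rfl fun e he => ?_
      rw [hct e, (Finset.mem_filter.1 he).2]
    rw [h1]
    by_cases hf : f ∈ outer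
    · have h0 : c (t f) = 0 := hout _ (by rwa [ht])
      simp [h0]
    · rw [hz.altProd_eq hf]
      set k := (Finset.univ.filter fun e => G.faceOf (e, true) = f).card
      split_ifs with ho
      · rcases Nat.even_or_odd (k + 1) with hk | hk
        · simp [hk.neg_one_pow]
        · rw [hk.neg_one_pow, ho.neg_one_zpow]
      · rw [Int.not_odd_iff_even] at ho
        rcases Nat.even_or_odd (k + 1) with hk | hk
        · simp [hk.neg_one_pow]
        · rw [hk.neg_one_pow, ho.neg_one_zpow]
  rw [← Finset.prod_fiberwise (s := Finset.univ) (g := fun e => G.faceOf (e, true)),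
    Finset.prod_congr rfl fun f _ => hface f, ← Finset.prod_filter, Finset.prod_pow_eq_pow_sum,
    Finset.sum_add_distrib, ← hcard, ← Finset.card_eq_sum_ones, ← Fintype.card_subtype, horb]
  push_cast
  rfl

/-- The relative sign of two dimer coverings is cancelled by a Kasteleyn weighting. -/
theorem IsComplexKasteleyn.prod_eq_sign_mul [Fintype E] [Fintype B] [DecidableEq B]
    {outer : Set G.Face} {z : E → ℂ}
    (hz : G.IsComplexKasteleyn outer z) (h₁ : G.IsDimerCovering M₁) (h₂ : G.IsDimerCovering M₂)
    {c : E → ℤ} (hφ : ∀ e, c (G.rotWB e) = c e) (hc : IsHeight G.rotW M₁ M₂ c)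
    (hout : ∀ e, G.faceOf (e, true) ∈ outer → c e = 0) :
    ∏ e ∈ M₁, z e
      = ((Equiv.Perm.sign (h₁.matching.trans h₂.matching.symm) : ℤˣ) : ℤ) * ∏ e ∈ M₂, z e := by
  classical
  have hz0 : ∀ e, z e ≠ 0 := fun e h => by simpa [h] using hz.1 e
  have hS : ∀ e, Odd (c (G.rotWB e)) ↔ Odd (c e) := fun e => by rw [hφ]
  rw [← prod_zpow_height hz0 hc, prod_zpow_eq_sign hz hφ hout hS,
    sign_rotWB_odd h₁ h₂ hφ hc hS]
  congr!

theorem graph_adj_black_white (e : E) :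
    G.graph.Adj (Sum.inl (G.black e)) (Sum.inr (G.white e)) := by
  simp only [graph, SimpleGraph.fromRel_adj]
  exact ⟨by simp, Or.inl ⟨e, rfl, rfl⟩⟩

theorem edgeComponent_eq_white (e : E) :
    G.edgeComponent e = G.graph.connectedComponentMk (Sum.inr (G.white e)) :=
  SimpleGraph.ConnectedComponent.sound (graph_adj_black_white e).reachable

theorem edgeComponent_rotB (e : E) : G.edgeComponent (G.rotB e) = G.edgeComponent e := by
  rw [edgeComponent, edgeComponent, vertex_perm G.rotB_sameCycle]

theorem edgeComponent_rotW (e : E) : G.edgeComponent (G.rotW e) = G.edgeComponent e := by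
  rw [edgeComponent_eq_white, edgeComponent_eq_white, vertex_perm G.rotW_sameCycle]

/-- A function of the vertices that takes the same value at both ends of every edge is constant on
connected components. -/
theorem eq_of_connectedComponentMk_eq {α : Type*} {s : B ⊕ W → α}
    (hs : ∀ e, s (Sum.inl (G.black e)) = s (Sum.inr (G.white e))) {u v : B ⊕ W}
    (h : G.graph.connectedComponentMk u = G.graph.connectedComponentMk v) : s u = s v := by
  obtain ⟨p⟩ := SimpleGraph.ConnectedComponent.exact h
  induction p with
  | nil => rfl
  | cons hadj _ ih =>
    rw [← ih (SimpleGraph.ConnectedComponent.sound (SimpleGraph.Walk.reachable ‹_›))]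
    simp only [graph, SimpleGraph.fromRel_adj] at hadj
    rcases hadj.2 with ⟨e, rfl, rfl⟩ | ⟨e, rfl, rfl⟩
    · exact hs e
    · exact (hs e).symm

/-- A function of the edges that is invariant under both rotations is constant on connected
components. -/
theorem eq_of_edgeComponent_eq {α : Type*} {h : E → α} (hB : ∀ e, h (G.rotB e) = h e)
    (hW : ∀ e, h (G.rotW e) = h e) {e e' : E} (hee : G.edgeComponent e = G.edgeComponent e') :
    h e = h e' := by
  let s : B ⊕ W → Set α := Sum.elim (fun b => h '' {e | G.black e = b})
    (fun w => h '' {e | G.white e = w})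
  have hb : ∀ e, s (Sum.inl (G.black e)) = {h e} := by
    intro e
    refine Set.eq_singleton_iff_unique_mem.2 ⟨⟨e, rfl, rfl⟩, ?_⟩
    rintro _ ⟨x, hx, rfl⟩
    exact apply_eq_of_sameCycle hB ((G.rotB_sameCycle _ _).2 hx)
  have hw : ∀ e, s (Sum.inr (G.white e)) = {h e} := by
    intro e
    refine Set.eq_singleton_iff_unique_mem.2 ⟨⟨e, rfl, rfl⟩, ?_⟩
    rintro _ ⟨x, hx, rfl⟩
    exact apply_eq_of_sameCycle hW ((G.rotW_sameCycle _ _).2 hx)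
  have := eq_of_connectedComponentMk_eq (s := s) (fun e => (hb e).trans (hw e).symm) hee
  rwa [hb, hb, Set.singleton_eq_singleton_iff] at this

/-- The connected component of a face. -/
def faceComponent (G : BipartiteMap B W E) : G.Face → G.graph.ConnectedComponent :=
  Quotient.lift (fun d : E × Bool => G.edgeComponent d.1) fun _ _ h =>
    apply_eq_of_sameCycle (f := G.facePerm) (g := fun d : E × Bool => G.edgeComponent d.1) (by
      rintro ⟨e, _ | _⟩
      · exact edgeComponent_rotB e
      · exact edgeComponent_rotW e) h

theorem faceIn_iff {f : G.Face} {c : G.graph.ConnectedComponent} :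
    G.FaceIn f c ↔ G.faceComponent f = c := by
  constructor
  · rintro ⟨d, rfl, rfl⟩
    rfl
  · rintro rfl
    obtain ⟨e, rfl⟩ := exists_faceOf_eq f
    exact ⟨_, rfl, rfl⟩

theorem natCard_eq_sum_fibers {α β : Type*} [Finite α] [Fintype β] (f : α → β) :
    Nat.card α = ∑ b, Nat.card {a // f a = b} := by
  rw [← Nat.card_sigma, Nat.card_congr (Equiv.sigmaFiberEquiv f)]

/-- Euler's formula for a planar map without isolated vertices, summed over all components. -/
theorem IsPlanar.card_add_card [Finite B] [Finite W] [Finite E] (hG : G.IsPlanar)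
    (hcomp : Function.Surjective G.edgeComponent) :
    Nat.card (B ⊕ W) + Nat.card G.Face
      = Nat.card E + 2 * Nat.card G.graph.ConnectedComponent := by
  have := Fintype.ofFinite G.graph.ConnectedComponent
  rw [natCard_eq_sum_fibers G.graph.connectedComponentMk, natCard_eq_sum_fibers G.faceComponent,
    natCard_eq_sum_fibers G.edgeComponent, Nat.card_eq_fintype_card, ← Finset.sum_add_distrib]
  have h : ∀ c, Nat.card {v // G.graph.connectedComponentMk v = c}
      + Nat.card {f // G.faceComponent f = c} = Nat.card {e // G.edgeComponent e = c} + 2 :=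
    fun c => by
      have := hG c (hcomp c)
      simpa only [faceIn_iff] using this
  rw [Finset.sum_congr rfl fun c _ => h c, Finset.sum_add_distrib]
  simp [mul_comm]

theorem finrank_le_card_of_forall_eq {α C : Type*} [Finite α] [Finite C] {κ : α → C}
    (hκ : Function.Surjective κ) (S : Submodule ℚ (α → ℚ))
    (hS : ∀ g ∈ S, ∀ a b, κ a = κ b → g a = g b) : Module.finrank ℚ S ≤ Nat.card C := by
  have := Fintype.ofFinite C
  choose t ht using hκ
  have h := LinearMap.finrank_le_finrank_of_injective
    (f := (LinearMap.funLeft ℚ ℚ t).comp S.subtype) (by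
      rintro ⟨g, hg⟩ ⟨g', hg'⟩ hgg
      ext a
      have := congrFun hgg (κ a)
      simp only [LinearMap.comp_apply, Submodule.subtype_apply, LinearMap.funLeft_apply] at this
      change g a = g' a
      rw [hS g hg a _ (ht _).symm, hS g' hg' a _ (ht _).symm]
      exact this)
  rwa [Module.finrank_fintype_fun_eq_card, ← Nat.card_eq_fintype_card] at h

/-- The boundary operator from faces to edges. -/
def faceBoundary (G : BipartiteMap B W E) : (G.Face → ℚ) →ₗ[ℚ] (E → ℚ) :=
  LinearMap.funLeft ℚ ℚ (fun e => G.faceOf (e, true))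
    - LinearMap.funLeft ℚ ℚ (fun e => G.faceOf (e, false))

theorem faceBoundary_apply (g : G.Face → ℚ) (e : E) :
    G.faceBoundary g e = g (G.faceOf (e, true)) - g (G.faceOf (e, false)) := rfl

open Classical in
/-- The incidence matrix, edges being directed from white to black. -/
noncomputable def incidence (G : BipartiteMap B W E) : Matrix (B ⊕ W) E ℚ :=
  Matrix.of fun v e => Sum.elim (fun b => if G.black e = b then 1 else 0)
    (fun w => if G.white e = w then -1 else 0) v

open Classical in
theorem incidence_mulVec_inl [Fintype E] (y : E → ℚ) (b : B) :
    (G.incidence.mulVec y) (Sum.inl b) = ∑ e, if G.black e = b then y e else 0 := by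
  simp [incidence, Matrix.mulVec, dotProduct]

open Classical in
theorem incidence_mulVec_inr [Fintype E] (y : E → ℚ) (w : W) :
    (G.incidence.mulVec y) (Sum.inr w) = - ∑ e, if G.white e = w then y e else 0 := by
  simp only [incidence, Matrix.mulVec, dotProduct, Matrix.of_apply, Sum.elim_inr,
    ← Finset.sum_neg_distrib]
  exact Finset.sum_congr rfl fun e _ => by split_ifs <;> simp

theorem incidence_transpose_mulVec [Fintype B] [Fintype W] (s : B ⊕ W → ℚ) (e : E) :
    (G.incidence.transpose.mulVec s) e = s (Sum.inl (G.black e)) - s (Sum.inr (G.white e)) := by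
  classical
  simp only [incidence, Matrix.mulVec, dotProduct, Matrix.transpose_apply, Matrix.of_apply,
    Fintype.sum_sum_type, Sum.elim_inl, Sum.elim_inr, ite_mul, one_mul, zero_mul, neg_mul]
  rw [Fintype.sum_eq_single (G.black e) fun b hb => if_neg hb.symm,
    Fintype.sum_eq_single (G.white e) fun w hw => if_neg hw.symm, if_pos rfl, if_pos rfl,
    sub_eq_add_neg]

theorem incidence_mulVec_faceBoundary [Fintype E] (g : G.Face → ℚ) :
    G.incidence.mulVec (G.faceBoundary g) = 0 := by
  classical
  ext v
  rcases v with b | w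
  · rw [incidence_mulVec_inl]
    simp only [faceBoundary_apply, ← Finset.sum_filter, Finset.sum_sub_distrib]
    rw [Finset.sum_filter, ← Equiv.sum_comp G.rotB, Finset.sum_filter]
    simp [faceOf_rotB, vertex_perm G.rotB_sameCycle]
  · rw [incidence_mulVec_inr]
    simp only [faceBoundary_apply, ← Finset.sum_filter, Finset.sum_sub_distrib]
    rw [Finset.sum_filter, Finset.sum_filter (f := fun e => g (G.faceOf (e, false))),
      ← Equiv.sum_comp G.rotW (fun e => if G.white e = w then g (G.faceOf (e, false)) else 0)]
    simp [faceOf_rotW, vertex_perm G.rotW_sameCycle]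

open Classical in
theorem sum_ite_mem_transversal {V : Type*} [Fintype E] {v : E → V}
    (h : ∀ x, ∃! e, e ∈ M ∧ v e = x) (x : V) :
    ∑ e, (if v e = x then if e ∈ M then (1 : ℚ) else 0 else 0) = 1 := by
  rw [Finset.sum_eq_single (pick h x)]
  · simp [vertex_pick h, pick_mem]
  · intro e _ he
    split_ifs with hv hm
    · exact absurd (eq_of_mem h hm (pick_mem h x) (by rw [hv, vertex_pick h])) he
    · rfl
    · rfl
  · simp

open Classical in
theorem sum_ite_sub_transversal {V : Type*} [Fintype E] {v : E → V}
    (h₁ : ∀ x, ∃! e, e ∈ M₁ ∧ v e = x) (h₂ : ∀ x, ∃! e, e ∈ M₂ ∧ v e = x) (x : V) :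
    ∑ e, (if v e = x then (if e ∈ M₁ then (1 : ℚ) else 0) - (if e ∈ M₂ then 1 else 0) else 0)
      = 0 := by
  refine Eq.trans ?_
    (sub_eq_zero.2 ((sum_ite_mem_transversal h₁ x).trans (sum_ite_mem_transversal h₂ x).symm))
  rw [← Finset.sum_sub_distrib]
  refine Finset.sum_congr rfl fun e _ => ?_
  split_ifs <;> simp

/-- In a planar map without isolated vertices every cycle is a boundary. -/
theorem IsPlanar.ker_incidence [Fintype B] [Fintype W] [Fintype E] (hG : G.IsPlanar)
    (hcomp : Function.Surjective G.edgeComponent) :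
    LinearMap.range G.faceBoundary = LinearMap.ker G.incidence.mulVecLin := by
  have := Fintype.ofFinite G.Face
  refine Submodule.eq_of_le_of_finrank_le ?_ ?_
  · rintro _ ⟨g, rfl⟩
    exact incidence_mulVec_faceBoundary g
  have h1 : Module.finrank ℚ (LinearMap.ker G.faceBoundary)
      ≤ Nat.card G.graph.ConnectedComponent := by
    refine finrank_le_card_of_forall_eq (κ := G.faceComponent) (fun c => ?_) _ ?_
    · obtain ⟨e, rfl⟩ := hcomp c
      exact ⟨G.faceOf (e, true), rfl⟩
    · intro g hg f f' hff
      obtain ⟨e, rfl⟩ := exists_faceOf_eq f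
      obtain ⟨e', rfl⟩ := exists_faceOf_eq f'
      have hker : ∀ e, g (G.faceOf (e, true)) = g (G.faceOf (e, false)) := fun e => by
        have := congrFun (LinearMap.mem_ker.1 hg) e
        rwa [faceBoundary_apply, Pi.zero_apply, sub_eq_zero] at this
      exact eq_of_edgeComponent_eq (h := fun e => g (G.faceOf (e, true)))
        (fun e => by simp only [faceOf_rotB, hker]) (fun e => by rw [hker, faceOf_rotW]) hff
  have h2 : Module.finrank ℚ (LinearMap.ker G.incidence.transpose.mulVecLin)
      ≤ Nat.card G.graph.ConnectedComponent := by
    refine finrank_le_card_of_forall_eq (κ := G.graph.connectedComponentMk)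
      (fun c => c.exists_rep) _ ?_
    intro s hs u v huv
    refine eq_of_connectedComponentMk_eq (fun e => ?_) huv
    have := congrFun (LinearMap.mem_ker.1 hs) e
    rwa [Matrix.mulVecLin_apply, incidence_transpose_mulVec, Pi.zero_apply, sub_eq_zero] at this
  have h3 := LinearMap.finrank_range_add_finrank_ker G.faceBoundary
  have h4 := LinearMap.finrank_range_add_finrank_ker G.incidence.mulVecLin
  have h5 := LinearMap.finrank_range_add_finrank_ker G.incidence.transpose.mulVecLin
  have h6 := G.incidence.rank_transpose
  have h7 := hG.card_add_card hcomp
  rw [Matrix.rank, Matrix.rank] at h6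
  rw [Module.finrank_fintype_fun_eq_card, ← Nat.card_eq_fintype_card] at h3 h4 h5
  omega

/-- The height function of two dimer coverings of a planar map. -/
theorem IsPlanar.exists_height [Fintype B] [Fintype W] [Fintype E] (hG : G.IsPlanar)
    {outer : Set G.Face} (houter : G.IsOuter outer) (h₁ : G.IsDimerCovering M₁)
    (h₂ : G.IsDimerCovering M₂) :
    ∃ c : E → ℤ, (∀ e, c (G.rotWB e) = c e) ∧ IsHeight G.rotW M₁ M₂ c ∧
      ∀ e, G.faceOf (e, true) ∈ outer → c e = 0 := by
  classical
  have hcomp : Function.Surjective G.edgeComponent := by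
    intro c
    obtain ⟨v, rfl⟩ := c.exists_rep
    rcases v with b | w
    · refine ⟨pick h₁.existsUnique_black b, ?_⟩
      rw [edgeComponent, vertex_pick h₁.existsUnique_black]
      rfl
    · refine ⟨pick h₁.existsUnique_white w, ?_⟩
      rw [edgeComponent_eq_white, vertex_pick h₁.existsUnique_white]
      rfl
  obtain ⟨g, hg⟩ : (fun e => (if e ∈ M₁ then (1 : ℚ) else 0) - if e ∈ M₂ then 1 else 0)
      ∈ LinearMap.range G.faceBoundary := by
    rw [hG.ker_incidence hcomp, LinearMap.mem_ker, Matrix.mulVecLin_apply]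
    ext v
    rcases v with b | w
    · rw [incidence_mulVec_inl]
      exact sum_ite_sub_transversal h₁.existsUnique_black h₂.existsUnique_black b
    · rw [incidence_mulVec_inr]
      exact neg_eq_zero.2
        (sum_ite_sub_transversal h₁.existsUnique_white h₂.existsUnique_white w)
  let c₀ : E → ℤ := fun e => ⌊g (G.faceOf (e, true))⌋
  let r : G.graph.ConnectedComponent → ℤ := fun k =>
    if h : ∃ e, G.faceOf (e, true) ∈ outer ∧ G.edgeComponent e = k then c₀ h.choose else 0
  refine ⟨fun e => c₀ e - r (G.edgeComponent e), fun e => ?_, fun e => ?_, fun e he => ?_⟩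
  · have hφ : c₀ (G.rotWB e) = c₀ e := by simp only [c₀, faceOf_rotWB]
    beta_reduce
    rw [hφ, rotWB, Equiv.Perm.mul_apply, edgeComponent_rotB, edgeComponent_rotW]
  · have h := congrFun hg (G.rotW e)
    rw [faceBoundary_apply, faceOf_rotW, sub_eq_iff_eq_add] at h
    have h' : g (G.faceOf (G.rotW e, true)) = g (G.faceOf (e, true))
        + (((if G.rotW e ∈ M₁ then 1 else 0) - (if G.rotW e ∈ M₂ then 1 else 0) : ℤ) : ℚ) := by
      rw [h]; push_cast; ring
    have hfl : c₀ (G.rotW e) = c₀ e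
        + ((if G.rotW e ∈ M₁ then 1 else 0) - (if G.rotW e ∈ M₂ then 1 else 0)) := by
      simp only [c₀]
      rw [h', Int.floor_add_intCast]
    simp only
    rw [edgeComponent_rotW, hfl]
    ring
  · have hex : ∃ e', G.faceOf (e', true) ∈ outer ∧ G.edgeComponent e' = G.edgeComponent e :=
      ⟨e, he, rfl⟩
    have hface := houter (G.edgeComponent e) _ hex.choose_spec.1 _ he
      ⟨_, rfl, hex.choose_spec.2⟩ ⟨_, rfl, rfl⟩
    simp only [r, dif_pos hex, c₀, hface, sub_self]

open Classical in
theorem IsDimerCovering.eq_image [Fintype B] (h : G.IsDimerCovering M) :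
    M = Finset.univ.image (pick h.existsUnique_black) := by
  ext e
  rw [Finset.mem_image]
  refine ⟨fun he => ⟨G.black e, Finset.mem_univ _, pick_apply _ he⟩, ?_⟩
  rintro ⟨b, -, rfl⟩
  exact pick_mem _ _

open Classical in
theorem isDimerCovering_image [Fintype B] {p : B → E} {τ : B ≃ W} (hb : ∀ b, G.black (p b) = b)
    (hw : ∀ b, G.white (p b) = τ b) : G.IsDimerCovering (Finset.univ.image p) := by
  refine ⟨fun b => ⟨p b, ⟨by simp, hb b⟩, ?_⟩, fun w => ⟨p (τ.symm w), ⟨by simp, by simp [hw]⟩, ?_⟩⟩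
  · rintro e ⟨he, rfl⟩
    obtain ⟨b, -, rfl⟩ := Finset.mem_image.1 he
    rw [hb]
  · rintro e ⟨he, rfl⟩
    obtain ⟨b, -, rfl⟩ := Finset.mem_image.1 he
    rw [hw, Equiv.symm_apply_apply]

theorem IsDimerCovering.prod_eq [Fintype B] (h : G.IsDimerCovering M) {R : Type*} [CommMonoid R]
    (k : E → R) : ∏ e ∈ M, k e = ∏ b, k (pick h.existsUnique_black b) := by
  classical
  conv_lhs => rw [h.eq_image]
  refine Finset.prod_image fun b _ b' _ hbb => ?_
  rw [← vertex_pick h.existsUnique_black b, hbb, vertex_pick h.existsUnique_black]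

open Classical in
/-- The expansion of the determinant as a signed sum over dimer coverings. -/
theorem det_adjMatrix [Fintype B] [DecidableEq B] [Fintype E] {R : Type*} [CommRing R]
    (k : E → R) (σ : B ≃ W) :
    ((G.adjMatrix k).submatrix id σ).det
      = ∑ M : {M // G.IsDimerCovering M},
          (((Equiv.Perm.sign (M.2.matching.trans σ.symm) : ℤˣ) : ℤ) : R) * ∏ e ∈ M.1, k e := by
  rw [← Matrix.det_transpose, Matrix.det_apply]
  simp only [Matrix.transpose_apply, Matrix.submatrix_apply, adjMatrix, Matrix.of_apply, id,
    Finset.prod_univ_sum, Finset.smul_sum]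
  rw [Finset.sum_sigma']
  symm
  refine Finset.sum_bij
    (fun M _ => ⟨M.2.matching.trans σ.symm, pick M.2.existsUnique_black⟩) ?_ ?_ ?_ ?_
  · rintro ⟨M, hM⟩ -
    simp only [Finset.mem_sigma, Finset.mem_univ, true_and, Fintype.mem_piFinset,
      Finset.mem_filter, Equiv.trans_apply, Equiv.apply_symm_apply]
    refine fun b => ⟨vertex_pick hM.existsUnique_black b, ?_⟩
    rw [← hM.matching_black (pick_mem hM.existsUnique_black b),
      vertex_pick hM.existsUnique_black]
  · rintro ⟨M, hM⟩ - ⟨M', hM'⟩ - h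
    have h2 : pick hM.existsUnique_black = pick hM'.existsUnique_black :=
      eq_of_heq (Sigma.mk.inj h).2
    exact Subtype.ext
      (hM.eq_image.trans ((congrArg (Finset.univ.image ·) h2).trans hM'.eq_image.symm))
  · rintro ⟨π, p⟩ hp
    simp only [Finset.mem_sigma, Finset.mem_univ, true_and, Fintype.mem_piFinset,
      Finset.mem_filter] at hp
    have hM := isDimerCovering_image (τ := π.trans σ) (fun b => (hp b).1) (fun b => (hp b).2)
    have hpick : pick hM.existsUnique_black = p := by
      funext b
      have h := pick_apply hM.existsUnique_black
        (Finset.mem_image_of_mem p (Finset.mem_univ b))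
      rwa [(hp b).1] at h
    have hmatch : hM.matching.trans σ.symm = π := by
      ext b
      have h := hM.matching_black (Finset.mem_image_of_mem p (Finset.mem_univ b))
      rw [(hp b).1, (hp b).2] at h
      rw [Equiv.trans_apply, h, Equiv.symm_apply_apply]
    exact ⟨⟨_, hM⟩, Finset.mem_univ _, by rw [hpick, hmatch]⟩
  · rintro ⟨M, hM⟩ -
    rw [hM.prod_eq k, Units.smul_def, zsmul_eq_mul]

open Classical in
theorem partitionFunction_eq_sum_subtype [Fintype E] (wt : E → ℝ) :
    G.partitionFunction wt = ∑ M : {M // G.IsDimerCovering M}, ∏ e ∈ M.1, wt e :=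
  Finset.sum_subtype _ (by simp) _

open Classical in
theorem partitionFunction_eq_zero [Fintype B] [Fintype W] [Fintype E] (wt : E → ℝ)
    (h : Fintype.card B ≠ Fintype.card W) : G.partitionFunction wt = 0 :=
  Finset.sum_eq_zero fun _ hM =>
    absurd (Fintype.card_congr (Finset.mem_filter.1 hM).2.matching) h

theorem partitionFunction_eq_norm_det [Fintype B] [DecidableEq B] [Fintype W] [Fintype E]
    (hG : G.IsPlanar) {outer : Set G.Face} (houter : G.IsOuter outer) {wt : E → ℝ}
    (hwt : ∀ e, 0 < wt e) {z : E → ℂ} (hz : G.IsComplexKasteleyn outer z) (σ : B ≃ W) :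
    G.partitionFunction wt = ‖((G.complexKasteleynMatrix z wt).submatrix id σ).det‖ := by
  classical
  rw [complexKasteleynMatrix, det_adjMatrix, partitionFunction_eq_sum_subtype]
  rcases isEmpty_or_nonempty {M // G.IsDimerCovering M} with hemp | ⟨⟨M₀, h₀⟩⟩
  · simp
  have hterm : ∀ M : {M // G.IsDimerCovering M},
      (((Equiv.Perm.sign (M.2.matching.trans σ.symm) : ℤˣ) : ℤ) : ℂ) * ∏ e ∈ M.1, z e * (wt e : ℂ)
        = ((((Equiv.Perm.sign (h₀.matching.trans σ.symm) : ℤˣ) : ℤ) : ℂ) * ∏ e ∈ M₀, z e)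
          * ((∏ e ∈ M.1, wt e : ℝ) : ℂ) := by
    rintro ⟨M, hM⟩
    obtain ⟨c, hφ, hc, hout⟩ := hG.exists_height houter hM h₀
    have hfac : hM.matching.trans h₀.matching.symm
        = (h₀.matching.trans σ.symm)⁻¹ * (hM.matching.trans σ.symm) := by
      ext b
      simp [Equiv.Perm.inv_def]
    have hs : (Equiv.Perm.sign (hM.matching.trans σ.symm) : ℤˣ)
        * Equiv.Perm.sign (hM.matching.trans h₀.matching.symm)
        = Equiv.Perm.sign (h₀.matching.trans σ.symm) := by
      rw [hfac, Equiv.Perm.sign_mul, Equiv.Perm.sign_inv, mul_left_comm, Int.units_mul_self,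
        mul_one]
    rw [Finset.prod_mul_distrib, hz.prod_eq_sign_mul hM h₀ hφ hc hout, ← hs]
    push_cast
    ring
  rw [Finset.sum_congr rfl fun M _ => hterm M, ← Finset.mul_sum, ← Complex.ofReal_sum, norm_mul,
    norm_mul, norm_prod, Finset.prod_congr rfl fun e _ => hz.1 e, Complex.norm_real,
    Real.norm_eq_abs,
    abs_of_nonneg (Finset.sum_nonneg fun M _ => Finset.prod_nonneg fun e _ => (hwt e).le)]
  rcases Int.units_eq_one_or (Equiv.Perm.sign (h₀.matching.trans σ.symm)) with h | h <;>
    simp [h]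

/-- A Kasteleyn weighting by signs is a Kasteleyn weighting by complex numbers. -/
theorem IsKasteleyn.isComplexKasteleyn [Fintype E] {outer : Set G.Face} {ε : E → ℤˣ}
    (hε : G.IsKasteleyn outer ε) : G.IsComplexKasteleyn outer fun e => ((ε e : ℤ) : ℂ) := by
  have hprod : ∀ f, G.altProd (fun e => ((ε e : ℤ) : ℂ)) f
      = (-1) ^ ((G.boundary f).filter fun d => ε d.1 = -1).card := by
    intro f
    rw [altProd, ← Finset.prod_const, Finset.prod_filter]
    refine Finset.prod_congr rfl fun d _ => ?_
    rcases Int.units_eq_one_or (ε d.1) with h | h <;> simp [h]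
  refine ⟨fun e => ?_, fun f hf => ⟨fun h => ⟨-1, by norm_num, ?_⟩, fun h => ⟨1, one_pos, ?_⟩⟩⟩
  · rcases Int.units_eq_one_or (ε e) with h | h <;> simp [h]
  · rw [hprod, ((hε f hf).1 h).neg_one_pow]
    simp
  · rw [hprod, ((hε f hf).2 h).neg_one_pow]
    simp

theorem complexKasteleynMatrix_sign [Fintype E] (ε : E → ℤˣ) (wt : E → ℝ) :
    G.complexKasteleynMatrix (fun e => ((ε e : ℤ) : ℂ)) wt
      = (G.kasteleynMatrix ε wt).map Complex.ofRealHom := by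
  ext b w
  simp [complexKasteleynMatrix, kasteleynMatrix, adjMatrix]

end BipartiteMap

theorem theorem1 {B W E : Type*} [Fintype B] [DecidableEq B] [Fintype W] [Fintype E]
    (G : BipartiteMap B W E) (hG : G.IsPlanar)
    (outer : Set G.Face) (houter : G.IsOuter outer)
    (wt : E → ℝ) (hwt : ∀ e, 0 < wt e) :
    (Fintype.card B ≠ Fintype.card W → G.partitionFunction wt = 0) ∧
    (∀ ε : E → ℤˣ, G.IsKasteleyn outer ε → ∀ σ : B ≃ W,
      G.partitionFunction wt = |((G.kasteleynMatrix ε wt).submatrix id σ).det|) ∧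
    (∀ z : E → ℂ, G.IsComplexKasteleyn outer z → ∀ σ : B ≃ W,
      G.partitionFunction wt = ‖((G.complexKasteleynMatrix z wt).submatrix id σ).det‖) := by
  refine ⟨fun h => BipartiteMap.partitionFunction_eq_zero wt h, fun ε hε σ => ?_,
    fun z hz σ => BipartiteMap.partitionFunction_eq_norm_det hG houter hwt hz σ⟩
  rw [BipartiteMap.partitionFunction_eq_norm_det hG houter hwt hε.isComplexKasteleyn σ,
    BipartiteMap.complexKasteleynMatrix_sign]
  change ‖(Complex.ofRealHom.mapMatrix ((G.kasteleynMatrix ε wt).submatrix id σ)).det‖ = _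
  rw [← RingHom.map_det, Complex.ofRealHom_eq_coe, Complex.norm_real, Real.norm_eq_abs]
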